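/- A real-time deterministic push-down automaton (DPDA) is a tuple $M=(Q,\Sigma,\Gamma,\delta,q_0,\bot,F)$ with finite sets $Q$ (states), $\Sigma$ (input alphabet), $\Gamma$ (stack alphabet), a total transition function $\delta:Q\times\Sigma\times\Gamma\to Q\times\Gamma^*$ (there are no $\epsilon$-transitions), an initial state $q_0\in Q$, a bottom symbol $\bot\in\Gamma$ and a set $F\subseteq Q$ of final states, such that whenever $\delta(q,a,x)=(q',\gamma)$ and $\bot$ occurs in $\gamma$, then $x=\bot$ and $\bot$ occurs in $\gamma$ only as its first letter. A configuration is a pair $(q,\upsilon)\in Q\times\Gamma^*$, where the top of the stack is the right end of $\upsilon$; reading $a\in\Sigma$ takes $(q,\upsilon x)$ to $(q',\upsilon\gamma)$ if $\delta(q,a,x)=(q',\gamma)$, and no step is possible from an empty stack. The language $\mathcal L(M)$ consists of all $w\in\Sigma^*$ that take $(q_0,\bot)$ to some $(q_f,\gamma)$ with $q_f\in F$ and $\gamma\in\Gamma^*$ arbitrary. A sequence of configurations is a stroke if none of its transitions decreases the stack height (upstroke) or none of them increases it (downstroke). $M$ is 1-turn if for every $w\in\mathcal L(M)$ the sequence of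 configurations induced by $w$ from $(q_0,\bot)$ can be split into at most two strokes. **Theorem.** The following two problems, whose instances are pairs of real-time 1-turn DPDAs $M_1,M_2$ over a common input alphabet (given by their transition tables), are undecidable: (1) Is $\mathcal L(M_1)\cap\mathcal L(M_2)=\emptyset$? (2) Is $\mathcal L(M_1)\subseteq\mathcal L(M_2)$? That is, for neither problem is there an algorithm that halts with the correct answer on every such pair. -/

import Mathlib

/-- A real-time deterministic push-down automaton `(Q, A, Γ, δ, q₀, ⊥, F)` with input alphabet `A`
and total transition function `δ` (no `ε`-transitions). Words over `Γ` are written from the bottom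
to the top of the stack. The symbol `⊥` may occur in a pushed word only as its first letter, and
only if the symbol that is replaced is `⊥`. -/
structure DPDA (Q A Γ : Type) where
  δ : Q → A → Γ → Q × List Γ
  start : Q
  bot : Γ
  final : Finset Q
  bot_rule : ∀ q a x, bot ∈ (δ q a x).2 →
    x = bot ∧ ∃ γ : List Γ, (δ q a x).2 = bot :: γ ∧ bot ∉ γ

namespace DPDA

variable {Q A Γ : Type}

/-- One step reading the letter `a`, on configurations (state, stack content); the top of the stack
is the right end of the list. There is no step from an empty stack. -/
def Step (M : DPDA Q A Γ) (a : A) (c c' : Q × List Γ) : Prop :=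
  ∃ (υ : List Γ) (x : Γ), c.2 = υ ++ [x] ∧
    c' = ((M.δ c.1 a x).1, υ ++ (M.δ c.1 a x).2)

/-- `ρ 0, …, ρ |w|` is the sequence of configurations induced by `w` from `(q₀, ⊥)`; the values of
`ρ` beyond `|w|` play no role. -/
def IsRun (M : DPDA Q A Γ) (w : List A) (ρ : ℕ → Q × List Γ) : Prop :=
  ρ 0 = (M.start, [M.bot]) ∧
    ∀ (i : ℕ) (hi : i < w.length), M.Step w[i] (ρ i) (ρ (i + 1))

/-- The accepted language: acceptance by final state, with arbitrary stack content. -/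
def language (M : DPDA Q A Γ) : Language A :=
  {w | ∃ ρ, M.IsRun w ρ ∧ (ρ w.length).1 ∈ M.final}

/-- Between the times `s` and `t` no transition decreases the stack height. -/
def IsUpstroke (ρ : ℕ → Q × List Γ) (s t : ℕ) : Prop :=
  ∀ i, s ≤ i → i < t → (ρ i).2.length ≤ (ρ (i + 1)).2.length

/-- Between the times `s` and `t` no transition increases the stack height. -/
def IsDownstroke (ρ : ℕ → Q × List Γ) (s t : ℕ) : Prop :=
  ∀ i, s ≤ i → i < t → (ρ (i + 1)).2.length ≤ (ρ i).2.length

/-- The sequence `ρ 0, …, ρ m` splits into at most `k` strokes, at the times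
`0 = t 0 ≤ t 1 ≤ … ≤ t k = m`. -/
def SplitsIntoStrokes (ρ : ℕ → Q × List Γ) (m k : ℕ) : Prop :=
  ∃ t : ℕ → ℕ, Monotone t ∧ t 0 = 0 ∧ t k = m ∧
    ∀ j < k, IsUpstroke ρ (t j) (t (j + 1)) ∨ IsDownstroke ρ (t j) (t (j + 1))

/-- An `n`-turn automaton: the run on every accepted word splits into at most `n + 1` strokes. -/
def IsNTurn (M : DPDA Q A Γ) (n : ℕ) : Prop :=
  ∀ w ∈ M.language, ∀ ρ, M.IsRun w ρ → SplitsIntoStrokes ρ w.length (n + 1)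

/-- Finite descriptions of automata, in the order `(Q, A, Γ, δ, q₀, ⊥, F)`: three cardinalities,
the table of `δ`, two indices, and the characteristic sequence of `F`. -/
abbrev Code : Type :=
  ℕ × ℕ × ℕ × List (List (List (ℕ × List ℕ))) × ℕ × ℕ × List Bool

/-- The description of an automaton whose states, letters and stack symbols are numbered. -/
def encode {q s g : ℕ} (M : DPDA (Fin q) (Fin s) (Fin g)) : Code :=
  (q, s, g,
    (List.finRange q).map (fun p => (List.finRange s).map (fun a => (List.finRange g).map
      (fun x => (((M.δ p a x).1 : ℕ), (M.δ p a x).2.map (fun y => (y : ℕ)))))),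
    (M.start : ℕ), (M.bot : ℕ),
    (List.finRange q).map (fun p => decide (p ∈ M.final)))

end DPDA

/-- A pair of real-time 1-turn deterministic push-down automata over a common input alphabet. Up to
renaming of states and symbols, every such pair of finite automata is of this form. -/
structure OneTurnPair where
  (letters states₁ states₂ stack₁ stack₂ : ℕ)
  M₁ : DPDA (Fin states₁) (Fin letters) (Fin stack₁)
  M₂ : DPDA (Fin states₂) (Fin letters) (Fin stack₂)
  oneTurn₁ : M₁.IsNTurn 1
  oneTurn₂ : M₂.IsNTurn 1

/-- The description of a pair of automata that an algorithm receives as its input. -/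
def OneTurnPair.encode (I : OneTurnPair) : DPDA.Code × DPDA.Code :=
  (I.M₁.encode, I.M₂.encode)

/-- The problem `P` on the instances `ι`, given by the encoding `enc`, is decidable: some algorithm
halts with the correct answer on the encoding of every instance. Nothing is asked of it on inputs
that encode no instance. -/
def DecidableProblem {ι α : Type} [Primcodable α] (enc : ι → α) (P : ι → Prop) : Prop :=
  ∃ f : α →. Bool, Partrec f ∧ ∀ i : ι, ∃ b : Bool, b ∈ f (enc i) ∧ (b = true ↔ P i)

/-! The proof reduces non-halting of one fixed program to both problems. Let `T` be a finite
letter-to-word transducer and `u` a word. A deterministic automaton can push `u` and the output of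
`T` while reading `z`, and then pop along a second word. Up to separators it accepts the words `z y`
where `y` is the reversal of `u ++ T(z)`. With the copying transducer and empty prefix, `y` is the
reversal of `z`. The two languages therefore meet if and only if `z = u ++ T(z)` has a solution
(`exists_both_accepted_iff`).

This fixed-point equation describes a queue machine. If `u` is the initial queue and `T` appends its
output for each removed letter, a solution `z` is the list of all letters that are ever in the
queue. A finite solution exists exactly when the machine stops (`Transducer.exists_reproduced_iff`).
A queue holding four stacks in cyclic order simulates a four-stack machine (`RoundRobin.respects`),
hence any partial recursive program.

For inclusion the second automaton is complemented by changing its final states. This is possible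
because its run never gets stuck and makes at most one turn on every word, accepted or not. -/

namespace DPDA

/-! ### Invariance under renaming of states and symbols -/

section Reindex

variable {Q A Γ Q' A' Γ' : Type}

/-- Renaming the states, letters and stack symbols of an automaton. -/
def reindex (M : DPDA Q A Γ) (e : Q ≃ Q') (f : A ≃ A') (g : Γ ≃ Γ') : DPDA Q' A' Γ' where
  δ q a x := (e (M.δ (e.symm q) (f.symm a) (g.symm x)).1,
    (M.δ (e.symm q) (f.symm a) (g.symm x)).2.map g)
  start := e M.start
  bot := g M.bot
  final := M.final.map e.toEmbedding
  bot_rule q a x h := by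
    have h' : M.bot ∈ (M.δ (e.symm q) (f.symm a) (g.symm x)).2 := by simpa using h
    obtain ⟨hx, γ, hγ, hb⟩ := M.bot_rule _ _ _ h'
    exact ⟨by rw [← hx]; simp, γ.map g, by simp [hγ], by simpa using hb⟩

variable (M : DPDA Q A Γ) (e : Q ≃ Q') (f : A ≃ A') (g : Γ ≃ Γ')

theorem reindex_step (a : A') (c c' : Q' × List Γ') :
    (M.reindex e f g).Step a c c' ↔
      M.Step (f.symm a) (Prod.map e.symm (List.map g.symm) c)
        (Prod.map e.symm (List.map g.symm) c') := by
  obtain ⟨q, s⟩ := c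
  obtain ⟨q', s'⟩ := c'
  simp only [Step, reindex, Prod.map_apply, Prod.mk.injEq]
  constructor
  · rintro ⟨υ, x, rfl, rfl, rfl⟩
    exact ⟨υ.map g.symm, g.symm x, by simp, by simp, by simp⟩
  · rintro ⟨υ, x, h₁, h₂, h₃⟩
    have h₁' := congrArg (List.map g) h₁
    have h₃' := congrArg (List.map g) h₃
    simp only [List.map_map, Equiv.self_comp_symm, List.map_id, List.map_append, List.map_cons,
      List.map_nil] at h₁' h₃'
    exact ⟨υ.map g, g x, h₁', by simp [← h₂], by simpa using h₃'⟩

theorem reindex_isRun (w : List A') (ρ : ℕ → Q' × List Γ') :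
    (M.reindex e f g).IsRun w ρ ↔
      M.IsRun (w.map f.symm) (fun i => Prod.map e.symm (List.map g.symm) (ρ i)) := by
  have h₀ : ρ 0 = (e M.start, [g M.bot]) ↔
      Prod.map e.symm (List.map g.symm) (ρ 0) = (M.start, [M.bot]) := by
    constructor
    · intro h
      simp [h]
    · intro h
      have := congrArg (Prod.map e (List.map g)) h
      simpa [Prod.map_map] using this
  simp only [IsRun, reindex_step, List.length_map, List.getElem_map]
  exact and_congr h₀ Iff.rfl

theorem mem_reindex_language (w : List A') :
    w ∈ (M.reindex e f g).language ↔ w.map f.symm ∈ M.language := by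
  constructor
  · rintro ⟨ρ, hρ, hf⟩
    refine ⟨_, (M.reindex_isRun e f g w ρ).1 hρ, ?_⟩
    simpa [reindex, Finset.mem_map_equiv] using hf
  · rintro ⟨ρ, hρ, hf⟩
    have key : (fun i => Prod.map e.symm (List.map g.symm) (Prod.map e (List.map g) (ρ i))) = ρ := by
      funext i
      simp [Prod.map_map]
    refine ⟨fun i => Prod.map e (List.map g) (ρ i), (M.reindex_isRun e f g w _).2 ?_, ?_⟩
    · rw [key]
      exact hρ
    · simpa [reindex, Finset.mem_map_equiv] using hf

theorem reindex_isNTurn {n : ℕ} (h : M.IsNTurn n) : (M.reindex e f g).IsNTurn n := by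
  intro w hw ρ hρ
  have := h _ ((M.mem_reindex_language e f g w).1 hw) _ ((M.reindex_isRun e f g w ρ).1 hρ)
  simpa [SplitsIntoStrokes, IsUpstroke, IsDownstroke] using this

end Reindex

end DPDA

/-! ### The automaton comparing a word with the output of a transducer -/

/-- A deterministic letter-to-word transducer on the alphabet `B` with states `P`. -/
structure Transducer (P B : Type) where
  start : P
  next : P → B → P
  out : P → B → List B

namespace Transducer

variable {P B : Type}

/-- The output word produced on an input word, starting in a given state. -/
def outputs (T : Transducer P B) : P → List B → List B
  | _, [] => []
  | p, b :: z => T.out p b ++ T.outputs (T.next p b) z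

/-- The one-state transducer that copies its input. -/
def copy (B : Type) : Transducer Unit B where
  start := ()
  next _ _ := ()
  out _ b := [b]

theorem outputs_copy (z : List B) : (copy B).outputs () z = z := by
  induction z with
  | nil => rfl
  | cons b z ih => simpa [outputs, copy] using ih

/-- The first `none` marks where `z` ends, so both automata must decode the same `z` from a common
word. -/
theorem map_some_append_none_inj {z z' : List B} {r r' : List (Option B)}
    (h : z.map some ++ none :: r = z'.map some ++ none :: r') : z = z' ∧ r = r' := by
  induction z generalizing z' with
  | nil => cases z' <;> simp_all
  | cons b z ih =>
    cases z' with
    | nil => simp at h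
    | cons c z' =>
      simp only [List.map_cons, List.cons_append, List.cons.injEq, Option.some.injEq] at h
      obtain ⟨rfl, h⟩ := h
      simpa using ih h

/-- The control states of the automaton that compares the output of a transducer with a word. -/
inductive Phase (P : Type) where
  | init : Phase P
  | up (p : P) : Phase P
  | down : Phase P
  | accepted : Phase P
  | dead : Phase P

instance [Finite P] : Finite (Phase P) := by
  refine Finite.of_injective (β := Option (Option (Option (Option P)))) (fun
    | .init => none
    | .down => some none
    | .accepted => some (some none)
    | .dead => some (some (some none))
    | .up p => some (some (some (some p)))) ?_
  intro a b h
  cases a <;> cases b <;> simp_all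

variable [DecidableEq B]

/-- The transition function of `Transducer.matcher`. -/
def matcherδ (T : Transducer P B) (u : List B) :
    Phase P → Option B → Option B → Phase P × List (Option B)
  | .init, none, x => (.up T.start, x :: u.map some)
  | .up p, some b, x => (.up (T.next p b), x :: (T.out p b).map some)
  | .up _, none, x => (.down, [x])
  | .down, some b, some c => if b = c then (.down, []) else (.dead, [some c])
  | .down, none, none => (.accepted, [none])
  | _, _, x => (.dead, [x])

/-- On a word `none z none y none`, the automaton pushes `u` and the output of `T` on `z`, and then
pops its stack along `y`. It is in the state `accepted` if `y` is the pushed word reversed. -/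
def matcher (T : Transducer P B) (u : List B) (F : Finset (Phase P)) :
    DPDA (Phase P) (Option B) (Option B) where
  δ := T.matcherδ u
  start := .init
  bot := none
  final := F
  bot_rule q a x h := by
    unfold matcherδ at h ⊢
    split at h <;> first | (split_ifs at h <;> simp_all) | simp_all
    all_goals
      rintro y - rfl
      simp at h

/-- A step of `Transducer.matcher`, on configurations in which the stack is written from the top,
without the bottom symbol. -/
def matcherStep (T : Transducer P B) (u : List B) : Phase P × List B → Option B → Phase P × List B
  | (.init, s), none => (.up T.start, u.reverse ++ s)
  | (.up p, s), some b => (.up (T.next p b), (T.out p b).reverse ++ s)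
  | (.up _, s), none => (.down, s)
  | (.down, c :: s), some b => if b = c then (.down, s) else (.dead, c :: s)
  | (.down, []), none => (.accepted, [])
  | (_, s), _ => (.dead, s)

/-- The configuration of `Transducer.matcher` with a given control state and stack content. -/
def matcherCfg (c : Phase P × List B) : Phase P × List (Option B) :=
  (c.1, none :: (c.2.reverse.map some))

variable (T : Transducer P B) (u : List B) (F : Finset (Phase P))

/-- The bottom symbol is never removed, so every letter admits exactly one step. Runs thus become a
fold of the total function `matcherStep`, and changing the final states can complement the language.
-/
theorem matcher_step_iff (a : Option B) (c : Phase P × List B) (c' : Phase P × List (Option B)) :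
    (T.matcher u F).Step a (matcherCfg c) c' ↔ c' = matcherCfg (T.matcherStep u c a) := by
  have det : ∀ υ x, (matcherCfg c).2 = υ ++ [x] →
      ((T.matcherδ u c.1 a x).1, υ ++ (T.matcherδ u c.1 a x).2) =
        matcherCfg (T.matcherStep u c a) := by
    intro υ x h
    obtain ⟨q, s⟩ := c
    cases s with
    | nil =>
      obtain ⟨rfl, rfl⟩ : υ = [] ∧ x = none := by
        cases υ <;> simp_all [matcherCfg]
      cases q <;> cases a <;> simp [matcherδ, matcherStep, matcherCfg]
    | cons b s =>
      obtain ⟨rfl, rfl⟩ : υ = none :: s.reverse.map some ∧ x = some b := by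
        have h' : (none :: s.reverse.map some) ++ [some b] = υ ++ [x] := by
          simpa [matcherCfg] using h
        have := List.append_inj' h' rfl
        simp_all
      cases q <;> cases a <;> simp [matcherδ, matcherStep, matcherCfg]
      split_ifs <;> simp
  have ex : ∃ υ x, (matcherCfg c).2 = υ ++ [x] := by
    obtain ⟨υ, x, h⟩ := List.eq_nil_or_concat (matcherCfg c).2 |>.resolve_left (by simp [matcherCfg])
    exact ⟨υ, x, by simpa using h⟩
  constructor
  · rintro ⟨υ, x, h, rfl⟩
    exact det υ x h
  · rintro rfl
    obtain ⟨υ, x, h⟩ := ex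
    exact ⟨υ, x, h, (det υ x h).symm⟩

/-- The configuration of `Transducer.matcher` after a word. -/
def matcherRun (w : List (Option B)) : Phase P × List B :=
  w.foldl (T.matcherStep u) (.init, [])

theorem matcherRun_take_succ (w : List (Option B)) (i : ℕ) (hi : i < w.length) :
    T.matcherRun u (w.take (i + 1)) = T.matcherStep u (T.matcherRun u (w.take i)) w[i] := by
  simp only [matcherRun, List.take_succ_eq_append_getElem hi, List.foldl_append, List.foldl_cons,
    List.foldl_nil]

theorem matcher_isRun_eq {w : List (Option B)} {ρ : ℕ → Phase P × List (Option B)}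
    (h : (T.matcher u F).IsRun w ρ) (i : ℕ) (hi : i ≤ w.length) :
    ρ i = matcherCfg (T.matcherRun u (w.take i)) := by
  induction i with
  | zero => simpa [matcherRun, matcherCfg, matcher] using h.1
  | succ i ih =>
    have := h.2 i hi
    rw [ih (by omega), matcher_step_iff] at this
    rw [this, matcherRun_take_succ]

theorem matcher_isRun (w : List (Option B)) :
    (T.matcher u F).IsRun w (fun i => matcherCfg (T.matcherRun u (w.take i))) := by
  refine ⟨by simp [matcherRun, matcherCfg, matcher], fun i hi => ?_⟩
  simp only [matcher_step_iff, T.matcherRun_take_succ u w i hi]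

theorem mem_matcher_language (w : List (Option B)) :
    w ∈ (T.matcher u F).language ↔ (T.matcherRun u w).1 ∈ F := by
  constructor
  · rintro ⟨ρ, hρ, hf⟩
    rw [T.matcher_isRun_eq u F hρ _ le_rfl, List.take_length] at hf
    exact hf
  · intro h
    refine ⟨_, T.matcher_isRun u F w, ?_⟩
    rw [List.take_length]
    exact h

/-- The control states in which the stack does not shrink. -/
def Phase.IsUp : Phase P → Prop
  | .init => True
  | .up _ => True
  | _ => False

theorem length_le_matcherStep (c : Phase P × List B) (a : Option B) (h : c.1.IsUp) :
    c.2.length ≤ (T.matcherStep u c a).2.length := by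
  obtain ⟨q, s⟩ := c
  cases q <;> cases a <;> simp_all [matcherStep, Phase.IsUp]

theorem matcherStep_length_le (c : Phase P × List B) (a : Option B) (h : ¬ c.1.IsUp) :
    (T.matcherStep u c a).2.length ≤ c.2.length := by
  obtain ⟨q, s⟩ := c
  cases q <;> cases a <;> cases s <;> simp_all [matcherStep, Phase.IsUp]
  split_ifs <;> simp

theorem not_isUp_matcherStep (c : Phase P × List B) (a : Option B) (h : ¬ c.1.IsUp) :
    ¬ (T.matcherStep u c a).1.IsUp := by
  obtain ⟨q, s⟩ := c
  cases q <;> cases a <;> cases s <;> simp_all [matcherStep, Phase.IsUp]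
  split_ifs <;> simp

end Transducer

/-- Applied to the property of being in a pushing phase, which is never regained once lost; `m` is
the time of the turn. -/
theorem exists_switch_time (p : ℕ → Prop) (n : ℕ) (h : ∀ i < n, ¬ p i → ¬ p (i + 1)) :
    ∃ m ≤ n, (∀ i < m, p i) ∧ ∀ i, m ≤ i → i < n → ¬ p i := by
  induction n with
  | zero => exact ⟨0, le_rfl, by simp, by simp⟩
  | succ n ih =>
    obtain ⟨m, hm, h₁, h₂⟩ := ih fun i hi => h i (by omega)
    by_cases hp : p n
    · refine ⟨n + 1, le_rfl, fun i hi => ?_, fun i _ _ => by omega⟩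
      by_contra hi'
      have : ∀ j, i ≤ j → j ≤ n → ¬ p j := by
        intro j hij
        induction j, hij using Nat.le_induction with
        | base => exact fun _ => hi'
        | succ j _ ihj => exact fun hj => h j (by omega) (ihj (by omega))
      exact this n (by omega) le_rfl hp
    · refine ⟨m, by omega, h₁, fun i hi hi' => ?_⟩
      rcases Nat.lt_succ_iff_lt_or_eq.1 hi' with h' | rfl
      · exact h₂ i hi h'
      · exact hp

namespace Transducer

variable {P B : Type} [DecidableEq B] (T : Transducer P B) (u : List B)

theorem matcher_isNTurn (F : Finset (Phase P)) : (T.matcher u F).IsNTurn 1 := by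
  -- Acceptance of `w` is discarded: the bound on turns holds for every choice of final states.
  intro w _ ρ hρ
  have hrun := T.matcher_isRun_eq u F hρ
  have hsucc := T.matcherRun_take_succ u w
  obtain ⟨m, hm, h₁, h₂⟩ := exists_switch_time
    (fun i => (T.matcherRun u (w.take i)).1.IsUp) w.length (by
      intro i hi h
      rw [hsucc i hi]
      exact T.not_isUp_matcherStep u _ _ h)
  refine ⟨fun j => if j = 0 then 0 else if j = 1 then m else w.length, ?_, by simp, by simp, ?_⟩
  · intro i j hij
    dsimp only
    split_ifs <;> omega
  · intro j hj
    obtain rfl | rfl : j = 0 ∨ j = 1 := by omega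
    · left
      intro i _ hi
      replace hi : i < m := by simpa using hi
      rw [hrun i (by omega), hrun (i + 1) (by omega), hsucc i (by omega)]
      simpa [matcherCfg] using T.length_le_matcherStep u _ _ (h₁ i hi)
    · right
      intro i hi hi'
      replace hi : m ≤ i := by simpa using hi
      replace hi' : i < w.length := by simpa using hi'
      rw [hrun i (by omega), hrun (i + 1) (by omega), hsucc i (by omega)]
      simpa [matcherCfg] using T.matcherStep_length_le u _ _ (h₂ i hi hi')

theorem foldl_dead (w : List (Option B)) (s : List B) :
    (w.foldl (T.matcherStep u) (.dead, s)).1 = .dead := by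
  induction w with
  | nil => rfl
  | cons a w ih => cases a <;> simpa [matcherStep] using ih

/-- Since `s` lists the stack from the top, the word popped is `s` itself. The closing `none` tests
that only the bottom symbol is left. -/
theorem foldl_down (w : List (Option B)) (s : List B) :
    (w.foldl (T.matcherStep u) (.down, s)).1 = .accepted ↔ w = s.map some ++ [none] := by
  induction w generalizing s with
  | nil => simp
  | cons a w ih =>
    cases a with
    | none =>
      cases s with
      | nil =>
        cases w with
        | nil => simp [matcherStep]
        | cons a w => cases a <;> simp [matcherStep, foldl_dead]
      | cons c s => simp [matcherStep, foldl_dead]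
    | some b =>
      cases s with
      | nil => simp [matcherStep, foldl_dead]
      | cons c s =>
        by_cases hbc : b = c
        · simp [matcherStep, hbc, ih]
        · simp [matcherStep, hbc, foldl_dead]

theorem foldl_up (w : List (Option B)) (p : P) (s : List B) :
    (w.foldl (T.matcherStep u) (.up p, s)).1 = .accepted ↔
      ∃ z : List B, w = z.map some ++ none :: (((T.outputs p z).reverse ++ s).map some ++ [none]) := by
  induction w generalizing p s with
  | nil => simp
  | cons a w ih =>
    cases a with
    | none =>
      simp only [List.foldl_cons, matcherStep, foldl_down]
      constructor
      · rintro rfl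
        exact ⟨[], by simp [outputs]⟩
      · rintro ⟨z, hz⟩
        cases z with
        | nil => simpa [outputs] using hz
        | cons b z => simp at hz
    | some b =>
      simp only [List.foldl_cons, matcherStep, ih]
      constructor
      · rintro ⟨z, rfl⟩
        exact ⟨b :: z, by simp [outputs]⟩
      · rintro ⟨z, hz⟩
        cases z with
        | nil => simp at hz
        | cons c z =>
          obtain ⟨rfl, rfl⟩ : b = c ∧ _ := by simpa using hz
          exact ⟨z, by simp [outputs]⟩

theorem matcherRun_accepted_iff (w : List (Option B)) :
    (T.matcherRun u w).1 = .accepted ↔ ∃ z : List B, w = none :: (z.map some ++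
      none :: ((u ++ T.outputs T.start z).reverse.map some ++ [none])) := by
  cases w with
  | nil => simp [matcherRun]
  | cons a w =>
    cases a with
    | none => simp [matcherRun, matcherStep, foldl_up]
    | some b => simp [matcherRun, matcherStep, foldl_dead]

/-- Two comparisons succeed simultaneously, with the copying transducer and with `T`, if and only
if some word is reproduced by `T` behind the prefix `u`. -/
theorem exists_both_accepted_iff :
    (∃ w, ((copy B).matcherRun [] w).1 = .accepted ∧ (T.matcherRun u w).1 = .accepted) ↔
      ∃ z, z = u ++ T.outputs T.start z := by
  simp only [matcherRun_accepted_iff]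
  constructor
  · rintro ⟨w, ⟨z, rfl⟩, z', h⟩
    -- Both automata read the same `z`; the remaining halves equate the reversed outputs.
    obtain ⟨rfl, h'⟩ := map_some_append_none_inj (List.cons.inj h).2
    refine ⟨z, ?_⟩
    have h'' := List.map_injective_iff.2 (Option.some_injective B) (List.append_cancel_right h')
    exact (outputs_copy z).symm.trans (List.reverse_injective h'')
  · rintro ⟨z, hz⟩
    refine ⟨_, ⟨z, rfl⟩, z, ?_⟩
    rw [← hz]
    have : (copy B).outputs (copy B).start z = z := outputs_copy z
    simp [this]

end Transducer

/-! ### Fixed points of transducers and queue machines -/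

open StateTransition Turing

namespace Transducer

variable {P B : Type}

/-- A transducer as a queue machine: in each step it removes the first letter of its queue and
appends the corresponding output to the queue. It stops if the queue is empty or if it has reached
a halting state. -/
def queueStep (T : Transducer P B) (halted : P → Bool) : P × List B → Option (P × List B)
  | (_, []) => none
  | (p, b :: u) => if halted p then none else some (T.next p b, u ++ T.out p b)

/-- If a transducer stays in halting states and produces no output there, then the queue machine
stops if and only if some word is reproduced behind the initial queue content. -/
theorem exists_reproduced_iff (T : Transducer P B) (halted : P → Bool)
    (hh : ∀ p b, halted p = true → T.out p b = [] ∧ halted (T.next p b) = true)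
    (p : P) (u : List B) :
    (∃ z, z = u ++ T.outputs p z) ↔ (eval (T.queueStep halted) (p, u)).Dom := by
  constructor
  · rintro ⟨z, hz⟩
    -- Each queue step consumes one letter of `z`, and the tail of `z` solves the equation for the
    -- new state and queue. Hence the machine stops within `z.length` steps.
    induction z generalizing p u with
    | nil =>
      have hu : u = [] := (List.append_eq_nil_iff.1 hz.symm).1
      exact Part.dom_iff_mem.2 ⟨_, mem_eval.2 ⟨.refl, by simp [hu, queueStep]⟩⟩
    | cons b z ih =>
      by_cases hnext : T.queueStep halted (p, u) = none
      · exact Part.dom_iff_mem.2 ⟨_, mem_eval.2 ⟨.refl, hnext⟩⟩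
      · cases u with
        | nil => simp [queueStep] at hnext
        | cons c u =>
          obtain ⟨rfl, hz⟩ := List.cons.inj hz
          have hp : ¬ halted p = true := fun hp => hnext (by simp [queueStep, hp])
          have hs : (T.next p b, u ++ T.out p b) ∈ T.queueStep halted (p, b :: u) := by
            simp [queueStep, hp]
          rw [reaches_eval (.single hs)]
          exact ih _ _ (by simpa [outputs] using hz)
  · intro h
    obtain ⟨c, hc⟩ := Part.dom_iff_mem.1 h
    obtain ⟨hr, hn⟩ := mem_eval.1 hc
    clear h hc
    have hhalt : ∀ (z : List B) (q : P), halted q = true → T.outputs q z = [] := by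
      intro z
      induction z with
      | nil => intros; rfl
      | cons b z ih => intro q hq; simp [outputs, hh q b hq, ih]
    suffices ∀ a : P × List B, Reaches (T.queueStep halted) a c → ∃ z, z = a.2 ++ T.outputs a.1 z by
      exact this _ hr
    intro a ha
    refine Relation.ReflTransGen.head_induction_on ha ?_ ?_
    · obtain ⟨q, v⟩ := c
      cases v with
      | nil => exact ⟨[], rfl⟩
      | cons b v =>
        have hq : halted q = true := by
          by_contra hq
          simp [queueStep, hq] at hn
        -- A halting state produces nothing more, so the letters left in the queue complete the
        -- solution.
        exact ⟨b :: v, by simp [hhalt _ q hq]⟩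
    · rintro ⟨q, v⟩ d hd _ ⟨z, hz⟩
      cases v with
      | nil => simp [queueStep] at hd
      | cons b v =>
        by_cases hq : halted q = true
        · simp [queueStep, hq] at hd
        · obtain rfl : (T.next q b, v ++ T.out q b) = d := by simpa [queueStep, hq] using hd
          exact ⟨b :: z, by simpa [outputs] using hz⟩

/-- The restriction of a transducer to a set of states that is closed under its transitions. -/
def restrict (T : Transducer P B) (S : Set P) (h₀ : T.start ∈ S)
    (h : ∀ p ∈ S, ∀ b, T.next p b ∈ S) : Transducer S B where
  start := ⟨T.start, h₀⟩
  next p b := ⟨T.next p b, h p p.2 b⟩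
  out p b := T.out p b

theorem outputs_restrict (T : Transducer P B) (S : Set P) (h₀ : T.start ∈ S)
    (h : ∀ p ∈ S, ∀ b, T.next p b ∈ S) (p : S) (z : List B) :
    (T.restrict S h₀ h).outputs p z = T.outputs p z := by
  induction z generalizing p with
  | nil => rfl
  | cons b z ih => exact congrArg (T.out p b ++ ·) (ih _)

end Transducer

/-! ### Simulating a four-stack machine with a queue -/

namespace RoundRobin

open PartrecToTM2 (K')

variable {G Λ σ : Type}

/-- The cyclic order in which the stacks are visited. -/
def nextStack : K' → K'
  | .main => .rev
  | .rev => .aux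
  | .aux => .stack
  | .stack => .main

/-- A statement of a multi-stack machine that is still to be executed (`none` if the machine has
halted), and its local variable. -/
abbrev Control (G Λ σ : Type) : Type := Option (TM2.Stmt (fun _ : K' => G) Λ σ) × σ

/-- Execution of the first instruction of a statement during the visit of the stack `k` with top
symbol `h`: the new control state, and the word that replaces the top symbol. An instruction that
concerns a different stack is postponed. -/
def visit (M : Λ → TM2.Stmt (fun _ : K' => G) Λ σ) :
    Control G Λ σ → K' → Option G → Control G Λ σ × List G
  | (none, v), _, h => ((none, v), h.toList)
  | (some (.push j f q), v), k, h =>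
    if k = j then ((some q, v), f v :: h.toList) else ((some (.push j f q), v), h.toList)
  | (some (.peek j f q), v), k, h =>
    if k = j then ((some q, f v h), h.toList) else ((some (.peek j f q), v), h.toList)
  | (some (.pop j f q), v), k, h =>
    if k = j then ((some q, f v h), []) else ((some (.pop j f q), v), h.toList)
  | (some (.load a q), v), _, h => ((some q, a v), h.toList)
  | (some (.branch p q₁ q₂), v), _, h => ((some (cond (p v) q₁ q₂), v), h.toList)
  | (some (.goto l), v), _, h => ((some (M (l v)), v), h.toList)
  | (some .halt, v), _, h => ((none, v), h.toList)

/-- A state of the round-robin transducer: the control state, the stack that is being visited, and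
whether its top is still to be read. -/
abbrev State (G Λ σ : Type) : Type := Control G Λ σ × K' × Bool

theorem toList_head?_append_tail (s : List G) : s.head?.toList ++ s.tail = s := by
  cases s <;> rfl

/-- The state is a halting state. -/
def halted (p : State G Λ σ) : Bool := p.1.1.isNone

/-- The transition of the round-robin transducer: a new state and an output. -/
def move (M : Λ → TM2.Stmt (fun _ : K' => G) Λ σ) (p : State G Λ σ) (b : Option G) :
    State G Λ σ × List (Option G) :=
  if halted p then (p, []) else
    match p, b with
    | (c, k, true), some x => (((visit M c k (some x)).1, k, false),
        (visit M c k (some x)).2.map some)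
    | (c, k, true), none => (((visit M c k none).1, nextStack k, true),
        (visit M c k none).2.map some ++ [none])
    | (c, k, false), some x => ((c, k, false), [some x])
    | (c, k, false), none => ((c, nextStack k, true), [none])

/-- The transducer whose queue machine simulates a machine with four stacks. The queue contains the
stacks in cyclic order, each followed by `none`. -/
def transducer (M : Λ → TM2.Stmt (fun _ : K' => G) Λ σ) (l : Λ) (v : σ) :
    Transducer (State G Λ σ) (Option G) where
  start := ((some (M l), v), .main, true)
  next p b := (move M p b).1
  out p b := (move M p b).2

/-- A stack as a segment of the queue. -/
def segment (s : List G) : List (Option G) := s.map some ++ [none]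

/-- The queue content that represents four stacks, starting with the stack `k`. -/
def queue (k : K') (S : K' → List G) : List (Option G) :=
  segment (S k) ++ segment (S (nextStack k)) ++ segment (S (nextStack (nextStack k))) ++
    segment (S (nextStack (nextStack (nextStack k))))

variable (M : Λ → TM2.Stmt (fun _ : K' => G) Λ σ) (l₀ : Λ) (v₀ : σ)

theorem halted_closed (p : State G Λ σ) (b : Option G) (h : halted p = true) :
    (transducer M l₀ v₀).out p b = [] ∧ halted ((transducer M l₀ v₀).next p b) = true := by
  simp [transducer, move, h]

/-- A step of the queue machine of the round-robin transducer. -/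
abbrev step : State G Λ σ × List (Option G) → Option (State G Λ σ × List (Option G)) :=
  (transducer M l₀ v₀).queueStep halted

theorem step_cons {p : State G Λ σ} (hp : halted p = false) (b : Option G) (u : List (Option G)) :
    step M l₀ v₀ (p, b :: u) = some ((move M p b).1, u ++ (move M p b).2) := by
  simp [step, Transducer.queueStep, hp, transducer]

theorem reaches_copy (q : TM2.Stmt (fun _ : K' => G) Λ σ) (v : σ) (k : K') (s : List G)
    (u : List (Option G)) :
    Reaches (step M l₀ v₀) (((some q, v), k, false), segment s ++ u)
      (((some q, v), nextStack k, true), u ++ segment s) := by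
  induction s generalizing u with
  | nil =>
    refine .single ?_
    rw [show segment ([] : List G) ++ u = none :: u from rfl, step_cons _ _ _ rfl]
    rfl
  | cons x s ih =>
    have h : (((some q, v), k, false), segment s ++ (u ++ [some x])) ∈
        step M l₀ v₀ (((some q, v), k, false), segment (x :: s) ++ u) := by
      rw [show segment (x :: s) ++ u = some x :: (segment s ++ u) from rfl, step_cons _ _ _ rfl]
      simp [move, halted]
    refine .head h ?_
    have := ih (u ++ [some x])
    rwa [show u ++ [some x] ++ segment s = u ++ segment (x :: s) by simp [segment]] at this

/-- One visit reads a segment from the front of the queue, changes at most its top, and writes it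
back at the end. An empty stack shows its end marker `none` at once, which serves as the absent top
symbol. -/
theorem reaches_visit (q : TM2.Stmt (fun _ : K' => G) Λ σ) (v : σ) (k : K') (s : List G)
    (u : List (Option G)) {q' : TM2.Stmt (fun _ : K' => G) Λ σ} {v' : σ} {r : List G}
    (h : visit M (some q, v) k s.head? = ((some q', v'), r)) :
    Reaches₁ (step M l₀ v₀) (((some q, v), k, true), segment s ++ u)
      (((some q', v'), nextStack k, true), u ++ segment (r ++ s.tail)) := by
  cases s with
  | nil =>
    refine .single ?_
    rw [show segment ([] : List G) ++ u = none :: u from rfl, step_cons _ _ _ rfl]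
    simp only [List.head?_nil] at h
    simp [move, halted, h, segment]
  | cons x s =>
    simp only [List.head?_cons] at h
    have h : (((some q', v'), k, false), segment s ++ (u ++ r.map some)) ∈
        step M l₀ v₀ (((some q, v), k, true), segment (x :: s) ++ u) := by
      rw [show segment (x :: s) ++ u = some x :: (segment s ++ u) from rfl, step_cons _ _ _ rfl]
      simp [move, halted, h]
    refine .head' h ?_
    have := reaches_copy M l₀ v₀ q' v' k s (u ++ r.map some)
    rwa [show u ++ r.map some ++ segment s = u ++ segment (r ++ s) by simp [segment]] at this

theorem reaches_queue (q : TM2.Stmt (fun _ : K' => G) Λ σ) (v : σ) (k : K') (S : K' → List G)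
    {q' : TM2.Stmt (fun _ : K' => G) Λ σ} {v' : σ} {r : List G}
    (h : visit M (some q, v) k (S k).head? = ((some q', v'), r)) :
    Reaches₁ (step M l₀ v₀) (((some q, v), k, true), queue k S)
      (((some q', v'), nextStack k, true),
        queue (nextStack k) (Function.update S k (r ++ (S k).tail))) := by
  have := reaches_visit M l₀ v₀ q v k (S k) (segment (S (nextStack k)) ++
    segment (S (nextStack (nextStack k))) ++ segment (S (nextStack (nextStack (nextStack k))))) h
  convert this using 2
  · simp [queue]
  · cases k <;> simp [queue, nextStack]

/-- An instruction on the stack `j` waits during the visits of the others. Since `nextStack` is a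
cycle of length four, at most three visits are idle. -/
theorem reaches_idle (q : TM2.Stmt (fun _ : K' => G) Λ σ) (v : σ) (S : K' → List G) (j : K')
    (h : ∀ k, k ≠ j → ∀ x, visit M (some q, v) k x = ((some q, v), x.toList)) (k : K') :
    Reaches (step M l₀ v₀) (((some q, v), k, true), queue k S)
      (((some q, v), j, true), queue j S) := by
  have one : ∀ k, k ≠ j → Reaches (step M l₀ v₀) (((some q, v), k, true), queue k S)
      (((some q, v), nextStack k, true), queue (nextStack k) S) := by
    intro k hk
    have := (reaches_queue M l₀ v₀ q v k S (h k hk _)).to_reflTransGen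
    rwa [toList_head?_append_tail, Function.update_eq_self] at this
  by_cases h₀ : k = j
  · rw [h₀]
    exact .refl
  refine (one k h₀).trans ?_
  by_cases h₁ : nextStack k = j
  · rw [h₁]
  refine (one _ h₁).trans ?_
  by_cases h₂ : nextStack (nextStack k) = j
  · rw [h₂]
  refine (one _ h₂).trans ?_
  have h₃ : nextStack (nextStack (nextStack k)) = j := by
    cases k <;> cases j <;> simp_all [nextStack]
  rw [h₃]

/-- The configurations of the queue machine that represent a configuration of the machine `M`. -/
def Represents (c : TM2.Cfg (fun _ : K' => G) Λ σ) (b : State G Λ σ × List (Option G)) : Prop :=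
  match c with
  | ⟨none, _, _⟩ => halted b.1 = true
  | ⟨some l, v, S⟩ => ∃ k, b = (((some (M l), v), k, true), queue k S)

theorem reaches_stepAux (q : TM2.Stmt (fun _ : K' => G) Λ σ) (v : σ) (S : K' → List G) (k : K') :
    ∃ b, Represents M (TM2.stepAux q v S) b ∧
      Reaches₁ (step M l₀ v₀) (((some q, v), k, true), queue k S) b := by
  -- The common inductive step: rotate the queue to the stack concerned, execute one instruction
  -- there, and continue from the next stack.
  have conclude : ∀ {q : TM2.Stmt (fun _ : K' => G) Λ σ} {v : σ} {S : K' → List G} {k j : K'}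
      (q' : TM2.Stmt (fun _ : K' => G) Λ σ) (v' : σ) (S' : K' → List G) (r : List G),
      Reaches (step M l₀ v₀) (((some q, v), k, true), queue k S)
        (((some q, v), j, true), queue j S) →
      visit M (some q, v) j (S j).head? = ((some q', v'), r) →
      Function.update S j (r ++ (S j).tail) = S' →
      (∀ k, ∃ b, Represents M (TM2.stepAux q' v' S') b ∧
        Reaches₁ (step M l₀ v₀) (((some q', v'), k, true), queue k S') b) →
      ∃ b, Represents M (TM2.stepAux q' v' S') b ∧
        Reaches₁ (step M l₀ v₀) (((some q, v), k, true), queue k S) b := by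
    intro q v S k j q' v' S' r hr hv hS ih
    subst hS
    obtain ⟨b, hb, hb'⟩ := ih (nextStack j)
    exact ⟨b, hb, (Relation.TransGen.trans_right hr (reaches_queue M l₀ v₀ q v j S hv)).trans hb'⟩
  induction q generalizing v S k with
  | push j f q ih =>
    exact conclude q v (Function.update S j (f v :: S j)) (f v :: (S j).head?.toList)
      (reaches_idle M l₀ v₀ _ v S j (fun k hk x => by simp [visit, hk]) k)
      (if_pos rfl) (by simp [toList_head?_append_tail]) (ih _ _)
  | peek j f q ih =>
    exact conclude q (f v (S j).head?) S (S j).head?.toList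
      (reaches_idle M l₀ v₀ _ v S j (fun k hk x => by simp [visit, hk]) k)
      (if_pos rfl) (by simp [toList_head?_append_tail]) (ih _ _)
  | pop j f q ih =>
    exact conclude q (f v (S j).head?) (Function.update S j (S j).tail) []
      (reaches_idle M l₀ v₀ _ v S j (fun k hk x => by simp [visit, hk]) k)
      (if_pos rfl) rfl (ih _ _)
  | load a q ih =>
    exact conclude q (a v) S (S k).head?.toList .refl rfl
      (by simp [toList_head?_append_tail]) (ih _ _)
  | branch p q₁ q₂ ih₁ ih₂ =>
    have : TM2.stepAux (.branch p q₁ q₂) v S = TM2.stepAux (cond (p v) q₁ q₂) v S := by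
      cases hp : p v <;> simp [hp]
    rw [this]
    refine conclude _ v S (S k).head?.toList .refl rfl
      (by simp [toList_head?_append_tail]) fun k => ?_
    cases p v
    · exact ih₂ v S k
    · exact ih₁ v S k
  | goto l =>
    refine ⟨_, ⟨nextStack k, rfl⟩, ?_⟩
    have := reaches_queue M l₀ v₀ (.goto l) v k S (q' := M (l v)) (v' := v) rfl
    rwa [toList_head?_append_tail, Function.update_eq_self] at this
  | halt =>
    obtain ⟨b, u, hu⟩ : ∃ b u, queue k S = b :: u := List.exists_cons_of_ne_nil (by
      simp [queue, segment])
    rw [hu]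
    -- Halting takes effect on the next letter, possibly inside a segment. This is harmless because
    -- `Represents` ignores the queue of a halted machine.
    refine ⟨_, ?_, .single (step_cons M l₀ v₀ rfl b u)⟩
    cases b <;> simp [Represents, move, halted, visit]

theorem respects : Respects (TM2.step M) (step M l₀ v₀) (Represents M) := by
  rintro ⟨l, v, S⟩ ⟨p, u⟩ h
  cases l with
  | none =>
    have hp : halted p = true := h
    cases u <;> simp [TM2.step, step, Transducer.queueStep, hp]
  | some l =>
    obtain ⟨k, h⟩ := h
    rw [h]
    exact reaches_stepAux M l₀ v₀ (M l) v S k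

/-- The machine `M` halts if and only if the round-robin transducer reproduces some word behind the
queue content that represents the initial stacks. -/
theorem exists_reproduced_iff (S : K' → List G) :
    (∃ z, z = queue .main S ++ (transducer M l₀ v₀).outputs (transducer M l₀ v₀).start z) ↔
      (eval (TM2.step M) ⟨some l₀, v₀, S⟩).Dom := by
  rw [Transducer.exists_reproduced_iff _ halted (halted_closed M l₀ v₀)]
  exact tr_eval_dom (respects M l₀ v₀) ⟨.main, rfl⟩

/-- The states of the round-robin transducer whose statement belongs to a given set of labels. -/
def support (L : Finset Λ) : Set (State G Λ σ) := {p | p.1.1 ∈ TM2.stmts M L}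

instance : Finite K' :=
  Set.finite_univ_iff.1 ((Set.toFinite {.main, .rev, .aux, .stack}).subset fun k _ => by
    cases k <;> simp)

/-- The labels may form an infinite type, but only statements that occur in the programs of labels
in `L` are needed. This makes the pushdown automaton finite. -/
theorem finite_support [Finite σ] (L : Finset Λ) : (support M L).Finite := by
  have : (((TM2.stmts M L : Set (Option (TM2.Stmt (fun _ : K' => G) Λ σ))) ×ˢ (Set.univ : Set σ)) ×ˢ
      (Set.univ : Set (K' × Bool))).Finite :=
    ((Finset.finite_toSet _).prod Set.finite_univ).prod Set.finite_univ
  exact this.subset fun p hp => ⟨⟨hp, trivial⟩, trivial⟩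

theorem label_mem_stmts {L : Finset Λ} {l : Λ} (h : l ∈ L) : some (M l) ∈ TM2.stmts M L := by
  simp only [TM2.stmts, Finset.some_mem_insertNone, Finset.mem_biUnion]
  exact ⟨l, h, TM2.stmts₁_self⟩

theorem visit_mem_stmts [Inhabited Λ] {L : Finset Λ} (hL : TM2.Supports M L) (c : Control G Λ σ)
    (k : K') (x : Option G) (h : c.1 ∈ TM2.stmts M L) : (visit M c k x).1.1 ∈ TM2.stmts M L := by
  obtain ⟨q, v⟩ := c
  cases q with
  | none => exact h
  | some q =>
    have sub : ∀ q', q' ∈ TM2.stmts₁ q → some q' ∈ TM2.stmts M L :=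
      fun q' hq => TM2.stmts_trans hq h
    cases q with
    | goto l => exact label_mem_stmts M (TM2.stmts_supportsStmt hL h v)
    | halt => simp [visit, TM2.stmts]
    | branch p q₁ q₂ =>
      refine sub _ ?_
      cases p v <;> simp [TM2.stmts₁, TM2.stmts₁_self]
    | load a q => exact sub _ (by simp [TM2.stmts₁, TM2.stmts₁_self])
    | _ j f q =>
      by_cases hk : k = j
      · simpa [visit, hk] using sub q (by simp [TM2.stmts₁, TM2.stmts₁_self])
      · simpa [visit, hk] using h

theorem next_mem_support [Inhabited Λ] {L : Finset Λ} (hL : TM2.Supports M L)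
    (p : State G Λ σ) (hp : p ∈ support M L) (b : Option G) :
    (transducer M l₀ v₀).next p b ∈ support M L := by
  obtain ⟨c, k, fresh⟩ := p
  simp only [transducer, move]
  split_ifs
  · exact hp
  · cases fresh <;> cases b
    · exact hp
    · exact hp
    · exact visit_mem_stmts M hL c k _ hp
    · exact visit_mem_stmts M hL c k _ hp

end RoundRobin

/-! ### Computing the initial stack content from the input -/

/-- The successor of a number given by its binary digits, the least significant one first. -/
def binaryIncrement : List Bool → List Bool
  | [] => [true]
  | false :: l => true :: l
  | true :: l => false :: binaryIncrement l

/-- The binary digits of a number, the least significant one first. -/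
def binaryDigits : ℕ → List Bool
  | 0 => []
  | n + 1 => binaryIncrement (binaryDigits n)

theorem primrec_binaryIncrement : Primrec binaryIncrement := by
  have h : Primrec₂ fun (_ : List Bool) (p : Bool × List Bool × List Bool) =>
      cond p.1 (false :: p.2.2) (true :: p.2.1) :=
    Primrec.cond (Primrec.fst.comp .snd)
      (Primrec.list_cons.comp (.const false) (Primrec.snd.comp (Primrec.snd.comp .snd)))
      (Primrec.list_cons.comp (.const true) (Primrec.fst.comp (Primrec.snd.comp .snd)))
  refine (Primrec.list_rec .id (.const [true]) h).of_eq fun l => ?_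
  induction l with
  | nil => rfl
  | cons b l ih =>
    cases b
    · rfl
    · simp only [id] at ih
      simp [binaryIncrement, ih]

theorem primrec_binaryDigits : Primrec binaryDigits :=
  (Primrec.nat_rec₁ ([] : List Bool) (primrec_binaryIncrement.comp Primrec.snd).to₂).of_eq
    fun n => by
      induction n with
      | zero => rfl
      | succ n ih => simp only [binaryDigits, ih]

/-- A binary digit as a stack symbol. -/
def binarySymbol (b : Bool) : PartrecToTM2.Γ' := cond b .bit1 .bit0

/-- The recursion of `PosNum.succ` is the carry propagation of `binaryIncrement`; this identifies
the machine's encoding of numbers with a primitive recursive one. -/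
theorem exists_digits_trPosNum (p : PosNum) : ∃ l : List Bool,
    PartrecToTM2.trPosNum p = l.map binarySymbol ∧
      PartrecToTM2.trPosNum p.succ = (binaryIncrement l).map binarySymbol := by
  induction p with
  | one => exact ⟨[true], rfl, rfl⟩
  | bit0 p ih =>
    obtain ⟨l, h, -⟩ := ih
    exact ⟨false :: l, congrArg _ h, congrArg _ h⟩
  | bit1 p ih =>
    obtain ⟨l, h, h'⟩ := ih
    exact ⟨true :: l, congrArg _ h, congrArg _ h'⟩

theorem binarySymbol_injective : Function.Injective binarySymbol := by
  intro a b
  cases a <;> cases b <;> simp [binarySymbol]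

theorem trNat_eq_map_binaryDigits (n : ℕ) :
    PartrecToTM2.trNat n = (binaryDigits n).map binarySymbol := by
  induction n with
  | zero => simp [binaryDigits]
  | succ n ih =>
    unfold PartrecToTM2.trNat at ih ⊢
    rw [Nat.cast_succ, Num.add_one]
    generalize (n : Num) = m at ih
    cases m with
    | zero =>
      have : binaryDigits n = [] := by
        have h : [] = (binaryDigits n).map binarySymbol := ih
        simpa using h.symm
      simp only [binaryDigits, this]
      rfl
    | pos p =>
      obtain ⟨l, h, h'⟩ := exists_digits_trPosNum p
      have : binaryDigits n = l :=
        List.map_injective_iff.2 binarySymbol_injective (ih.symm.trans h)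
      rw [binaryDigits, this]
      exact h'

/-- The list is fixed, so no uniformity in its entries is needed. It serves for transition tables of
constant dimensions. -/
theorem primrec_map_of_forall {α β γ : Type} [Primcodable α] [Primcodable γ] (l : List β)
    (F : β → α → γ) (h : ∀ b, Primrec (F b)) : Primrec fun a => l.map (F · a) := by
  induction l with
  | nil => exact .const []
  | cons b l ih => exact Primrec.list_cons.comp (h b) ih

/-! ### Effective construction of the instances -/

namespace Transducer

theorem exists_numbered_iff {B : Type} [Finite B] (p : List (Option B) → Prop) :
    (∃ w : List (Fin (Nat.card (Option B))), p (w.map (Finite.equivFin (Option B)).symm)) ↔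
      ∃ w, p w :=
  ((List.map_surjective_iff.2 (Finite.equivFin (Option B)).symm.surjective).exists).symm

variable {P B : Type} [DecidableEq B] [Finite B] [Finite P]

/-- `Transducer.matcher` with numbered states, letters and stack symbols. -/
noncomputable def numberedMatcher (T : Transducer P B) (u : List B) (F : Finset (Phase P)) :
    DPDA (Fin (Nat.card (Phase P))) (Fin (Nat.card (Option B))) (Fin (Nat.card (Option B))) :=
  (T.matcher u F).reindex (Finite.equivFin _) (Finite.equivFin _) (Finite.equivFin _)

theorem mem_numberedMatcher_language (T : Transducer P B) (u : List B) (F : Finset (Phase P))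
    (w : List (Fin (Nat.card (Option B)))) :
    w ∈ (T.numberedMatcher u F).language ↔
      (T.matcherRun u (w.map (Finite.equivFin (Option B)).symm)).1 ∈ F := by
  rw [numberedMatcher, DPDA.mem_reindex_language, mem_matcher_language]

theorem primrec_encode_numberedMatcher (T : Transducer P B) (u : ℕ → List B)
    (F : Finset (Phase P))
    (hu : ∀ φ : B → ℕ, Primrec fun n => (u n).map φ) :
    Primrec fun n => (T.numberedMatcher (u n) F).encode := by
  refine Primrec.pair (.const _) (Primrec.pair (.const _) (Primrec.pair (.const _)
    (Primrec.pair ?_ (Primrec.pair (.const ((T.numberedMatcher [] F).start : ℕ))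
      (Primrec.pair (.const ((T.numberedMatcher [] F).bot : ℕ)) (primrec_map_of_forall _ _
        fun p => .const (decide (p ∈ (T.numberedMatcher [] F).final))))))))
  refine primrec_map_of_forall _ _ fun p => primrec_map_of_forall _ _ fun a =>
    primrec_map_of_forall _ _ fun x => ?_
  simp only [numberedMatcher, DPDA.reindex, matcher]
  generalize (Finite.equivFin (Phase P)).symm p = p
  generalize (Finite.equivFin (Option B)).symm a = a
  generalize (Finite.equivFin (Option B)).symm x = x
  -- The word `u n` enters the table only where the first separator is read; all other entries are
  -- constant in `n`.
  by_cases hp : p = .init ∧ a = none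
  · obtain ⟨rfl, rfl⟩ := hp
    refine (Primrec.pair (.const (Finite.equivFin (Phase P) (.up T.start) : ℕ))
      (Primrec.list_cons.comp (.const (Finite.equivFin (Option B) x : ℕ))
        (hu fun b => (Finite.equivFin (Option B) (some b) : ℕ)))).of_eq fun n => ?_
    simp [matcherδ, ← List.map_eq_flatMap, Function.comp_def]
  · have h : ∀ n, T.matcherδ (u n) p a x = T.matcherδ [] p a x := by
      intro n
      cases p <;> cases a <;> cases x <;> simp_all [matcherδ]
    simp only [h]
    exact .const _

/-- The pair of the automaton for the copying transducer and that for a given transducer. -/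
noncomputable def oneTurnPair (T : Transducer P B) (u : List B) (F : Finset (Phase P)) :
    OneTurnPair where
  letters := _
  states₁ := _
  states₂ := _
  stack₁ := _
  stack₂ := _
  M₁ := (copy B).numberedMatcher [] {.accepted}
  M₂ := T.numberedMatcher u F
  oneTurn₁ := DPDA.reindex_isNTurn _ _ _ _ (matcher_isNTurn _ _ _)
  oneTurn₂ := DPDA.reindex_isNTurn _ _ _ _ (matcher_isNTurn _ _ _)

theorem primrec_encode_oneTurnPair (T : Transducer P B) (u : ℕ → List B) (F : Finset (Phase P))
    (hu : ∀ φ : B → ℕ, Primrec fun n => (u n).map φ) :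
    Primrec fun n => (T.oneTurnPair (u n) F).encode :=
  Primrec.pair (.const ((copy B).numberedMatcher [] {.accepted}).encode)
    (T.primrec_encode_numberedMatcher u F hu)

theorem oneTurnPair_disjoint_iff (T : Transducer P B) (u : List B) :
    (T.oneTurnPair u {.accepted}).M₁.language ⊓ (T.oneTurnPair u {.accepted}).M₂.language = ⊥ ↔
      ¬ ∃ z, z = u ++ T.outputs T.start z := by
  rw [← exists_both_accepted_iff, ← exists_numbered_iff, not_exists]
  refine Set.eq_empty_iff_forall_notMem.trans (forall_congr' fun w => not_congr ?_)
  refine (and_congr (mem_numberedMatcher_language _ _ _ w)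
    (mem_numberedMatcher_language _ _ _ w)).trans ?_
  simp only [Finset.mem_singleton]

/-- With `F` the complement of `accepted`, the second language is the complement of the former one,
so inclusion expresses disjointness. -/
theorem oneTurnPair_subset_iff (T : Transducer P B) (u : List B) (F : Finset (Phase P))
    (hF : ∀ q, q ∈ F ↔ q ≠ .accepted) :
    (T.oneTurnPair u F).M₁.language ≤ (T.oneTurnPair u F).M₂.language ↔
      ¬ ∃ z, z = u ++ T.outputs T.start z := by
  rw [← exists_both_accepted_iff, ← exists_numbered_iff, not_exists]
  refine forall_congr' fun w => ?_
  refine (imp_congr (mem_numberedMatcher_language _ _ _ w)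
    (mem_numberedMatcher_language _ _ _ w)).trans ?_
  simp only [Finset.mem_singleton, hF, not_and, ne_eq]

end Transducer

/-! ### Undecidability of the two problems -/

/-- The halting problem for one suitable program is undecidable. -/
theorem exists_code_not_computablePred :
    ∃ c : ToPartrec.Code, ¬ ComputablePred fun n : ℕ => (c.eval [n]).Dom := by
  -- A universal program: on input `n` it runs the `n`-th code on `0`. With the program fixed, the
  -- transducer is fixed too, and only the initial queue varies.
  have hf : Partrec fun n : ℕ => (Denumerable.ofNat Nat.Partrec.Code n).eval 0 :=
    Nat.Partrec.Code.eval_part.comp (Computable.ofNat _) (.const 0)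
  obtain ⟨c, hc⟩ := ToPartrec.Code.exists_code (Nat.Partrec'.part_iff₁.2 hf)
  refine ⟨c, fun h => ComputablePred.halting_problem 0 ?_⟩
  obtain ⟨f, hf, hp⟩ := ComputablePred.computable_iff.1 h
  refine ComputablePred.computable_iff.2 ⟨fun d => f (Encodable.encode d), hf.comp .encode, ?_⟩
  funext d
  rw [← congrFun hp (Encodable.encode d)]
  have := hc ⟨[Encodable.encode d], rfl⟩
  rw [this]
  simp [List.Vector.head]

/-- A problem is undecidable if the complement of an undecidable set of numbers reduces to it. -/
theorem not_decidableProblem_of_reduction {ι α : Type} [Primcodable α] {enc : ι → α}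
    {P : ι → Prop} {p : ℕ → Prop} (hp : ¬ ComputablePred p) (I : ℕ → ι)
    (hI : Primrec fun n => enc (I n)) (h : ∀ n, P (I n) ↔ ¬ p n) : ¬ DecidableProblem enc P := by
  rintro ⟨f, hf, hd⟩
  choose b hb hbP using fun n => hd (I n)
  -- The algorithm `f` may diverge elsewhere, but it halts on every encoded instance, so its
  -- composition with the reduction is total.
  have hcomp : Computable b := (hf.comp hI.to_comp).of_eq fun n => Part.eq_some_iff.2 (hb n)
  refine hp ((ComputablePred.computable_iff.2 ⟨fun n => !b n, Primrec.not.to_comp.comp hcomp, ?_⟩))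
  funext n
  have := (hbP n).trans (h n)
  cases hbn : b n <;> simp_all

/-- The queue that represents the initial stacks of the machine for a program with input `n`. -/
def inputQueue (n : ℕ) : List (Option PartrecToTM2.Γ') :=
  RoundRobin.queue .main (PartrecToTM2.K'.elim (PartrecToTM2.trList [n]) [] [] [])

theorem primrec_inputQueue (φ : Option PartrecToTM2.Γ' → ℕ) :
    Primrec fun n => (inputQueue n).map φ := by
  have h : Primrec fun n => (binaryDigits n).map (fun b => φ (some (binarySymbol b))) :=
    Primrec.list_map primrec_binaryDigits ((Primrec.dom_finite fun b => φ (some (binarySymbol b))).comp .snd).to₂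
  -- The constant tail consists of the symbol ending the number and four end markers, one for the
  -- main stack and three for the empty stacks.
  refine (Primrec.list_append.comp h (.const ((some .cons :: List.replicate 4 none).map φ))).of_eq
    fun n => ?_
  simp [inputQueue, RoundRobin.queue, RoundRobin.segment, RoundRobin.nextStack,
    PartrecToTM2.trList, trNat_eq_map_binaryDigits, PartrecToTM2.K'.elim, List.replicate,
    Function.comp_def]

/-- Halting of a program is expressed by a finite transducer. -/
theorem exists_transducer (c : ToPartrec.Code) :
    ∃ (P : Type) (_ : Finite P) (T : Transducer P (Option PartrecToTM2.Γ')),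
      ∀ n, (∃ z, z = inputQueue n ++ T.outputs T.start z) ↔ (c.eval [n]).Dom := by
  let l := PartrecToTM2.trNormal c .halt
  let L := PartrecToTM2.codeSupp c .halt
  -- The default label is chosen to be the start label `l`, so that `hL.1` places `l` in `L`.
  have hL : @TM2.Supports _ _ _ _ ⟨l⟩ PartrecToTM2.tr L := PartrecToTM2.tr_supports c .halt
  let T := RoundRobin.transducer PartrecToTM2.tr l none
  let S := RoundRobin.support PartrecToTM2.tr L
  have h₀ : T.start ∈ S := RoundRobin.label_mem_stmts PartrecToTM2.tr hL.1
  have hS : ∀ p ∈ S, ∀ b, T.next p b ∈ S :=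
    @RoundRobin.next_mem_support _ _ _ PartrecToTM2.tr l none ⟨l⟩ L hL
  refine ⟨S, RoundRobin.finite_support PartrecToTM2.tr L, T.restrict S h₀ hS, fun n => ?_⟩
  simp only [Transducer.outputs_restrict]
  refine (RoundRobin.exists_reproduced_iff PartrecToTM2.tr l none _).trans ?_
  have := PartrecToTM2.tr_eval c [n]
  rw [PartrecToTM2.init] at this
  rw [this]
  rfl

theorem mainTheorem2 :
    ¬ DecidableProblem OneTurnPair.encode (fun I => I.M₁.language ⊓ I.M₂.language = ⊥) ∧
    ¬ DecidableProblem OneTurnPair.encode (fun I => I.M₁.language ≤ I.M₂.language) := by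
  obtain ⟨c, hc⟩ := exists_code_not_computablePred
  obtain ⟨P, _, T, hT⟩ := exists_transducer c
  constructor
  · have hI := T.primrec_encode_oneTurnPair inputQueue {.accepted} primrec_inputQueue
    exact not_decidableProblem_of_reduction hc _ hI fun n =>
      (T.oneTurnPair_disjoint_iff (inputQueue n)).trans (not_congr (hT n))
  · let F : Finset (Transducer.Phase P) :=
      (Set.toFinite {q : Transducer.Phase P | q ≠ .accepted}).toFinset
    have hI := T.primrec_encode_oneTurnPair inputQueue F primrec_inputQueue
    exact not_decidableProblem_of_reduction hc _ hI fun n =>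
      (T.oneTurnPair_subset_iff (inputQueue n) F fun q => by simp [F]).trans (not_congr (hT n))
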